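/- Let $ZFC^-$ be $ZFC$ without the power set axiom, with collection in place of replacement and with the well-ordering principle (every set can be well-ordered) in place of choice. Let $\hat V$ be a model of $ZFC^-$ which is $\omega$-nonstandard, i.e. some element of $\hat\omega = \omega^{\hat V}$ has infinitely many predecessors in $\hat\omega$. For a linear order $(L,<)$ and infinite regular cardinals $\kappa,\theta$, a $(\kappa,\theta)$-cut in $L$ is a pair of sequences $(a_\alpha:\alpha<\kappa)$, $(b_\beta:\beta<\theta)$ from $L$ such that $a_\alpha<a_{\alpha'}<b_{\beta'}<b_\beta$ for all $\alpha<\alpha'<\kappa$ and $\beta<\beta'<\theta$, and such that there is no $c\in L$ with $a_\alpha<c<b_\beta$ for all $\alpha<\kappa$, $\beta<\theta$. Let $\mathfrak p_{\hat V}$ be the minimum of $\kappa+\theta$ over all pairs $(\kappa,\theta)$ of infinite regular cardinals such that $(\hat\omega,\hat<)$ has a $(\kappa,\theta)$-cut. A set $p(x)$ of first-order formulas of the language $\{\in\}$ in one free variable $x$ with parameters from $\hat V$ is a partial type over $\hat V$ if every finite subset of $p(x)$ is satisfied by some element of $\hat V$. A subset of $\hat V$ is pseudofinite if it is contained in (the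 extension of) some $\hat Y\in\hat V$ which is finite in the sense of $\hat V$; an element $\hat X \in \hat V$ is pseudofinite if the set of its $\hat V$-elements is. Theorem. Let $p(x)$ be a partial type over $\hat V$ of cardinality $\lambda<\mathfrak p_{\hat V}$, and suppose that $p(x)$ contains the formula "$x\in\hat X$" for some pseudofinite $\hat X\in\hat V$. Then $p(x)$ is realized in $\hat V$, i.e. some element of $\hat V$ satisfies all formulas of $p(x)$. -/

import Mathlib

open Cardinal FirstOrder

universe u

/-- The only symbol of the language of set theory: a binary relation symbol. -/
inductive SetRelSymbol : ℕ → Type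
  | mem : SetRelSymbol 2

/-- The first-order language `{∈}` of set theory. -/
def setLang : FirstOrder.Language.{0, 0} where
  Functions := fun _ => Empty
  Relations := SetRelSymbol

namespace SetModel

section

variable {V : Type u} [setLang.Structure V]

/-- The membership relation of the structure `V`. -/
def Mem (x y : V) : Prop :=
  FirstOrder.Language.Structure.RelMap (L := setLang) SetRelSymbol.mem ![x, y]

infix:50 " ∈ₘ " => SetModel.Mem

/-- `V` satisfies `c = {a, b}`. -/
def IsUPair (c a b : V) : Prop :=
  ∀ x, x ∈ₘ c ↔ x = a ∨ x = b

/-- `V` satisfies `c = (a, b)`, the Kuratowski pair `{{a}, {a, b}}`. -/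
def IsPair (c a b : V) : Prop :=
  ∀ z, z ∈ₘ c ↔ IsUPair z a a ∨ IsUPair z a b

/-- `V` satisfies `(a, b) ∈ r`. -/
def PairMem (r a b : V) : Prop :=
  ∃ c, IsPair c a b ∧ c ∈ₘ r

/-- `V` satisfies "`r` is a (strict) well-order of the set `a`": irreflexive, transitive and total
on `a`, and every nonempty subset of `a` that is an element of `V` has a least element. -/
def WellOrders (r a : V) : Prop :=
  (∀ x, x ∈ₘ a → ¬ PairMem r x x) ∧
  (∀ x y z, x ∈ₘ a → y ∈ₘ a → z ∈ₘ a → PairMem r x y → PairMem r y z → PairMem r x z) ∧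
  (∀ x y, x ∈ₘ a → y ∈ₘ a → x = y ∨ PairMem r x y ∨ PairMem r y x) ∧
  (∀ s, (∀ x, x ∈ₘ s → x ∈ₘ a) → (∃ x, x ∈ₘ s) →
    ∃ x, x ∈ₘ s ∧ ∀ y, y ∈ₘ s → y = x ∨ PairMem r x y)

/-- `V` satisfies "`w` is an inductive set": `∅ ∈ w`, and `x ∪ {x} ∈ w` whenever `x ∈ w`. -/
def IsInductive (w : V) : Prop :=
  (∃ e, e ∈ₘ w ∧ ∀ x, ¬ x ∈ₘ e) ∧
  (∀ x, x ∈ₘ w → ∃ y, y ∈ₘ w ∧ ∀ z, z ∈ₘ y ↔ z ∈ₘ x ∨ z = x)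

/-- `V` satisfies "`n` is a natural number", i.e. `n ∈ ω`, where `ω` is the least inductive set. -/
def IsNat (n : V) : Prop :=
  ∀ w : V, IsInductive w → n ∈ₘ w

/-- `V` satisfies "`f` is a bijection from `a` to `b`". -/
def IsBijection (f a b : V) : Prop :=
  (∀ c, c ∈ₘ f → ∃ x y, x ∈ₘ a ∧ y ∈ₘ b ∧ IsPair c x y) ∧
  (∀ x, x ∈ₘ a → ∃! y, PairMem f x y) ∧
  (∀ y, y ∈ₘ b → ∃! x, PairMem f x y)

/-- `V` satisfies "`a` is finite". -/
def IsFiniteSet (a : V) : Prop :=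
  ∃ n f : V, IsNat n ∧ IsBijection f a n

/-- A subset of `V` is pseudofinite if it is contained in an element of `V` which is finite in
the sense of `V`. -/
def Pseudofinite (S : Set V) : Prop :=
  ∃ Y : V, IsFiniteSet Y ∧ ∀ x ∈ S, x ∈ₘ Y

end

/-- `V ⊨ ZFC⁻`: ZFC without the power set axiom, with collection in place of replacement and
the well-ordering principle in place of choice. Each field says that `V` satisfies the
corresponding axiom; the two schemes range over all first-order formulas in the language `{∈}`
with parameters from `V`. -/
structure IsModelZFCMinus (V : Type u) [setLang.Structure V] : Prop where
  extensionality : ∀ a b : V, (∀ x, x ∈ₘ a ↔ x ∈ₘ b) → a = b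
  foundation : ∀ a : V, (∃ x, x ∈ₘ a) → ∃ x, x ∈ₘ a ∧ ∀ y, y ∈ₘ x → ¬ y ∈ₘ a
  pairing : ∀ a b : V, ∃ c : V, IsUPair c a b
  union : ∀ a : V, ∃ b : V, ∀ x, x ∈ₘ b ↔ ∃ y, y ∈ₘ a ∧ x ∈ₘ y
  infinity : ∃ w : V, IsInductive w
  separation : ∀ (φ : setLang[[V]].Formula (Fin 1)) (a : V),
    ∃ b : V, ∀ x, x ∈ₘ b ↔ x ∈ₘ a ∧ φ.Realize ![x]
  collection : ∀ (φ : setLang[[V]].Formula (Fin 2)) (a : V),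
    (∀ x, x ∈ₘ a → ∃ y, φ.Realize ![x, y]) →
      ∃ b : V, ∀ x, x ∈ₘ a → ∃ y, y ∈ₘ b ∧ φ.Realize ![x, y]
  wellOrdering : ∀ a : V, ∃ r : V, WellOrders r a

/-- `V` is `ω`-nonstandard: some natural number of `V` has infinitely many predecessors. -/
def OmegaNonstandard (V : Type u) [setLang.Structure V] : Prop :=
  ∃ n : V, IsNat n ∧ {m : V | m ∈ₘ n}.Infinite

/-- The set `ω` of natural numbers of `V`, as a type. -/
def Omega (V : Type u) [setLang.Structure V] : Type u :=
  {n : V // IsNat n}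

/-- The order of the natural numbers of `V`: `m < n` iff `m ∈ n`. -/
instance (V : Type u) [setLang.Structure V] : LT (Omega V) where
  lt m n := m.1 ∈ₘ n.1

/-- A `(κ, θ)`-pre-cut in `L`: sequences `(a_α : α < κ)` and `(b_β : β < θ)` such that
`a_α < a_α' < b_β' < b_β` for all `α < α'` and `β < β'`. -/
def IsPreCut {L : Type u} [LT L] (κ θ : Cardinal.{u})
    (a : Set.Iio κ.ord → L) (b : Set.Iio θ.ord → L) : Prop :=
  ∀ α α' β β', α < α' → β < β' → a α < a α' ∧ a α' < b β' ∧ b β' < b β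

/-- A cut: a pre-cut which is not filled by any element of `L`. -/
def IsCut {L : Type u} [LT L] (κ θ : Cardinal.{u})
    (a : Set.Iio κ.ord → L) (b : Set.Iio θ.ord → L) : Prop :=
  IsPreCut κ θ a b ∧ ¬ ∃ c : L, ∀ α β, a α < c ∧ c < b β

/-- The cut spectrum of `(L, <)`: the pairs `(κ, θ)` of infinite regular cardinals such that `L`
admits a `(κ, θ)`-cut. -/
def cutSpectrum (L : Type u) [LT L] : Set (Cardinal.{u} × Cardinal.{u}) :=
  {q | q.1.IsRegular ∧ q.2.IsRegular ∧ ∃ a b, IsCut (L := L) q.1 q.2 a b}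

/-- `cut(L, <)`, the least `κ + θ` with `(κ, θ)` in the cut spectrum. -/
noncomputable def cut (L : Type u) [LT L] : Cardinal.{u} :=
  sInf ((fun q => q.1 + q.2) '' cutSpectrum L)

/-- The cardinal `𝔭_V = cut(ω, <)`, computed in the natural numbers of `V`. -/
noncomputable def pCard (V : Type u) [setLang.Structure V] : Cardinal.{u} :=
  cut (Omega V)

section

variable {V : Type u} [setLang.Structure V]

/-- A set of formulas in one free variable with parameters from `V` is a partial type over `V` if
each of its finite subsets is satisfied by some element of `V`. -/
def IsPartialType (p : Set (setLang[[V]].Formula (Fin 1))) : Prop :=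
  ∀ F : Set (setLang[[V]].Formula (Fin 1)), F ⊆ p → F.Finite → ∃ x : V, ∀ φ ∈ F, φ.Realize ![x]

/-- `p` is realized in `V`: one element of `V` satisfies all formulas of `p`. -/
def IsRealized (p : Set (setLang[[V]].Formula (Fin 1))) : Prop :=
  ∃ x : V, ∀ φ ∈ p, φ.Realize ![x]

/-- The formula `x ∈ X` in the free variable `x` with the parameter `X`. -/
def memFormula (X : V) : setLang[[V]].Formula (Fin 1) :=
  FirstOrder.Language.Relations.formula₂ (L := setLang[[V]]) (Sum.inl SetRelSymbol.mem) (FirstOrder.Language.Term.var 0) (setLang.con X).term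

theorem realize_memFormula (X x : V) : (memFormula X).Realize ![x] ↔ x ∈ₘ X :=
  FirstOrder.Language.Formula.realize_rel₂ (L := setLang[[V]]) (v := ![x])
    (R := Sum.inl SetRelSymbol.mem) (t₁ := FirstOrder.Language.Term.var 0)
    (t₂ := (setLang.con X).term)

end

end SetModel

/-! A bijection in the model from a finite set covering `X` to a natural number `n` turns each
finite part of `p` into a nonempty internal subset of `n`. These subsets form an external directed
family `F` of fewer than `𝔭` sets, and a common element of `F` codes a realization
(`exists_mem_of_directed`).

The common element comes from climbing a tree of internal descending sequences of subsets of `n`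
whose last term meets every member of `F`. Directedness lets the last term be intersected with any
prescribed member of `F` (`Node.exists_refinement`). A transfinite climb treats all members of `F`
in turn, provided that small chains have upper bounds (`Node.exists_upper_bound`).

Upper bounds come from the absence of small cuts, used twice. An internal lexicographic coding of
sets by numbers turns a chain of nodes into two families of numbers, one below the other; a number
between them decodes to a path through the whole chain (`Node.exists_path`). That path may run too
far to keep meeting `F`. A second separation, between the last places where the path meets each `A ∈
F` and the places reached by the chain, tells where to stop. -/

set_option synthInstance.maxSize 100000
set_option synthInstance.maxHeartbeats 0

/-! ### Definability by instance search, separation and replacement -/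

namespace SetModel

/-- A type of tuples of elements of `V`, with coordinates indexed by `Idx`. -/
class Ctx (V : Type u) (C : Type u) where
  Idx : Type
  val : C → Idx → V

instance (V : Type u) : Ctx V PUnit.{u + 1} := ⟨Empty, fun _ i => i.elim⟩

instance (V C : Type u) [Ctx V C] : Ctx V (V × C) :=
  ⟨Ctx.Idx V C ⊕ Unit, fun c => Sum.elim (Ctx.val c.2) fun _ => c.1⟩

section

variable {V : Type u} [setLang.Structure V] {C : Type u} [Ctx V C]

/-- `P` is first-order definable with parameters. -/
class Def (V : Type u) [setLang.Structure V] {C : Type u} [Ctx V C] (P : C → Prop) : Prop where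
  out : ∃ φ : setLang[[V]].Formula (Ctx.Idx V C), ∀ c, φ.Realize (Ctx.val c) ↔ P c

/-- `f` is given by a term. -/
class Tm (f : C → V) : Prop where
  out : ∃ t : setLang[[V]].Term (Ctx.Idx V C), ∀ c, t.realize (Ctx.val c) = f c

/-- `g` forgets some of the coordinates. -/
class Pj (V : Type u) {C C' : Type u} [Ctx V C] [Ctx V C'] (g : C → C') : Prop where
  out : ∃ ρ : Ctx.Idx V C' → Ctx.Idx V C, ∀ c i, Ctx.val (V := V) (g c) i = Ctx.val c (ρ i)

instance : Pj V (fun c : C => c) := ⟨id, fun _ _ => rfl⟩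

instance {C' : Type u} [Ctx V C'] {g : C → V × C'} [h : Pj V g] : Pj V (fun c => (g c).2) :=
  let ⟨ρ, hρ⟩ := h.out
  ⟨fun i => ρ (Sum.inl i), fun c i => hρ c (Sum.inl i)⟩

instance {C' : Type u} [Ctx V C'] {g : C → V × C'} [h : Pj V g] : Tm (fun c => (g c).1) :=
  let ⟨ρ, hρ⟩ := h.out
  ⟨.var (ρ (Sum.inr ())), fun c => (hρ c (Sum.inr ())).symm⟩

instance (a : V) : Tm (fun _ : C => a) :=
  ⟨(setLang.con a).term, fun _ => FirstOrder.Language.Term.realize_constants⟩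

instance {f g : C → V} [hf : Tm f] [hg : Tm g] : Def V (fun c => f c ∈ₘ g c) := by
  obtain ⟨s, hs⟩ := hf.out
  obtain ⟨t, ht⟩ := hg.out
  refine ⟨FirstOrder.Language.Relations.formula₂ (L := setLang[[V]])
    (Sum.inl SetRelSymbol.mem) s t, fun c => ?_⟩
  rw [← hs, ← ht]
  exact FirstOrder.Language.Formula.realize_rel₂ (L := setLang[[V]])
    (R := Sum.inl SetRelSymbol.mem)

instance {f g : C → V} [hf : Tm f] [hg : Tm g] : Def V (fun c => f c = g c) := by
  obtain ⟨s, hs⟩ := hf.out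
  obtain ⟨t, ht⟩ := hg.out
  exact ⟨s.equal t, fun c => by rw [FirstOrder.Language.Formula.realize_equal, hs, ht]⟩

instance {P : C → Prop} [hP : Def V P] : Def V (fun c => ¬ P c) := by
  obtain ⟨φ, hφ⟩ := hP.out
  exact ⟨φ.not, fun c => by rw [FirstOrder.Language.Formula.realize_not, hφ]⟩

instance {P Q : C → Prop} [hP : Def V P] [hQ : Def V Q] : Def V (fun c => P c ∧ Q c) := by
  obtain ⟨φ, hφ⟩ := hP.out
  obtain ⟨ψ, hψ⟩ := hQ.out
  exact ⟨φ ⊓ ψ, fun c => by rw [FirstOrder.Language.Formula.realize_inf, hφ, hψ]⟩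

instance {P Q : C → Prop} [hP : Def V P] [hQ : Def V Q] : Def V (fun c => P c ∨ Q c) := by
  obtain ⟨φ, hφ⟩ := hP.out
  obtain ⟨ψ, hψ⟩ := hQ.out
  exact ⟨φ ⊔ ψ, fun c => by rw [FirstOrder.Language.Formula.realize_sup, hφ, hψ]⟩

instance {P Q : C → Prop} [hP : Def V P] [hQ : Def V Q] : Def V (fun c => P c → Q c) := by
  obtain ⟨φ, hφ⟩ := hP.out
  obtain ⟨ψ, hψ⟩ := hQ.out
  exact ⟨φ.imp ψ, fun c => by rw [FirstOrder.Language.Formula.realize_imp, hφ, hψ]⟩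

instance {P Q : C → Prop} [hP : Def V P] [hQ : Def V Q] : Def V (fun c => P c ↔ Q c) := by
  obtain ⟨φ, hφ⟩ := hP.out
  obtain ⟨ψ, hψ⟩ := hQ.out
  exact ⟨φ.iff ψ, fun c => by rw [FirstOrder.Language.Formula.realize_iff, hφ, hψ]⟩

/-- The bound variable becomes the head coordinate of a longer context. With the instances for
connectives and atoms, instance search can thus build the formula for a predicate written out in
terms of `∈ₘ`. -/
instance {P : V → C → Prop} [hP : Def V (fun c : V × C => P c.1 c.2)] :
    Def V (fun c => ∃ x, P x c) := by
  obtain ⟨φ, hφ⟩ := hP.out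
  refine ⟨FirstOrder.Language.Formula.iExs Unit φ, fun c => ?_⟩
  rw [FirstOrder.Language.Formula.realize_iExs]
  constructor
  · rintro ⟨i, hi⟩
    exact ⟨i (), (hφ (i (), c)).1 hi⟩
  · rintro ⟨x, hx⟩
    exact ⟨fun _ => x, (hφ (x, c)).2 hx⟩

instance {P : V → C → Prop} [hP : Def V (fun c : V × C => P c.1 c.2)] :
    Def V (fun c => ∀ x, P x c) := by
  have : (fun c => ∀ x, P x c) = fun c => ¬ ∃ x, ¬ P x c := by
    funext c; simp
  rw [this]
  infer_instance

/-- Substitution of terms in definable predicates. -/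
theorem Def.subst {C' : Type u} [Ctx V C'] {P : C' → Prop} (hP : Def V P) {g : C → C'}
    (hg : ∀ i, Tm fun c => Ctx.val (V := V) (g c) i) : Def V (fun c => P (g c)) := by
  obtain ⟨φ, hφ⟩ := hP.out
  choose t ht using fun i => (hg i).out
  refine ⟨FirstOrder.Language.BoundedFormula.subst φ t, fun c => ?_⟩
  rw [← hφ, FirstOrder.Language.Formula.Realize, FirstOrder.Language.BoundedFormula.realize_subst]
  simp only [ht]
  rfl

theorem Def.subst₁ {P : V → Prop} (hP : Def V (fun c : V × PUnit => P c.1)) {f : C → V}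
    (hf : Tm f) : Def V (fun c => P (f c)) :=
  hP.subst (g := fun c => (f c, ⟨⟩)) <| by
    rintro (i | i)
    exacts [i.elim, hf]

theorem Def.subst₂ {P : V → V → Prop} (hP : Def V (fun c : V × V × PUnit => P c.1 c.2.1))
    {f g : C → V} (hf : Tm f) (hg : Tm g) : Def V (fun c => P (f c) (g c)) :=
  hP.subst (g := fun c => (f c, g c, ⟨⟩)) <| by
    rintro ((i | i) | i)
    exacts [i.elim, hg, hf]

theorem Def.subst₃ {P : V → V → V → Prop}
    (hP : Def V (fun c : V × V × V × PUnit => P c.1 c.2.1 c.2.2.1)) {f g h : C → V}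
    (hf : Tm f) (hg : Tm g) (hh : Tm h) : Def V (fun c => P (f c) (g c) (h c)) :=
  hP.subst (g := fun c => (f c, g c, h c, ⟨⟩)) <| by
    rintro (((i | i) | i) | i)
    exacts [i.elim, hh, hg, hf]

instance {f g h : C → V} [hf : Tm f] [hg : Tm g] [hh : Tm h] :
    Def V (fun c => IsUPair (f c) (g c) (h c)) := by
  refine Def.subst₃ ?_ hf hg hh
  unfold IsUPair; infer_instance

instance {f g h : C → V} [hf : Tm f] [hg : Tm g] [hh : Tm h] :
    Def V (fun c => IsPair (f c) (g c) (h c)) := by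
  refine Def.subst₃ ?_ hf hg hh
  unfold IsPair; infer_instance

instance {f g h : C → V} [hf : Tm f] [hg : Tm g] [hh : Tm h] :
    Def V (fun c => PairMem (f c) (g c) (h c)) := by
  refine Def.subst₃ ?_ hf hg hh
  unfold PairMem; infer_instance

instance {f : C → V} [hf : Tm f] : Def V (fun c => IsInductive (f c)) := by
  refine Def.subst₁ ?_ hf
  unfold IsInductive; infer_instance

instance {f : C → V} [hf : Tm f] : Def V (fun c => IsNat (f c)) := by
  refine Def.subst₁ ?_ hf
  unfold IsNat; infer_instance

instance (φ : setLang[[V]].Formula (Fin 1)) {f : C → V} [hf : Tm f] :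
    Def V (fun c => φ.Realize ![f c]) := by
  refine Def.subst₁ (P := fun x => φ.Realize ![x]) ?_ hf
  refine ⟨φ.relabel fun _ => Sum.inr (), fun c => ?_⟩
  rw [FirstOrder.Language.Formula.realize_relabel]
  exact iff_of_eq (congrArg _ (funext fun i => by rw [Subsingleton.elim i 0]; rfl))

end

section

variable {V : Type u} [setLang.Structure V] [hV : Fact (IsModelZFCMinus V)]

/-- Separation for definable predicates. -/
theorem exists_sep (P : V → Prop) [hP : Def V (fun c : V × PUnit => P c.1)] (a : V) :
    ∃ b : V, ∀ x, x ∈ₘ b ↔ x ∈ₘ a ∧ P x := by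
  obtain ⟨φ, hφ⟩ := hP.out
  obtain ⟨b, hb⟩ := hV.out.separation (φ.relabel fun _ => 0) a
  refine ⟨b, fun x => ?_⟩
  rw [hb, FirstOrder.Language.Formula.realize_relabel, ← hφ (x, ⟨⟩)]
  refine and_congr_right fun _ => iff_of_eq (congrArg _ (funext fun i => ?_))
  rcases i with i | i
  exacts [i.elim, rfl]

/-- Replacement for definable relations. -/
theorem exists_image (P : V → V → Prop) [hP : Def V (fun c : V × V × PUnit => P c.1 c.2.1)] (a : V)
    (h : ∀ x, x ∈ₘ a → ∃ y, ∀ z, P x z ↔ z = y) :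
    ∃ b : V, ∀ y, y ∈ₘ b ↔ ∃ x, x ∈ₘ a ∧ P x y := by
  obtain ⟨φ, hφ⟩ := hP.out
  have key : ∀ x y, (φ.relabel (Sum.elim (Sum.elim Empty.elim fun _ => 1) fun _ => 0) :
      setLang[[V]].Formula (Fin 2)).Realize ![x, y] ↔ P x y := by
    intro x y
    rw [FirstOrder.Language.Formula.realize_relabel, ← hφ (x, y, ⟨⟩)]
    refine iff_of_eq (congrArg _ (funext fun i => ?_))
    rcases i with (i | i) | i
    exacts [i.elim, rfl, rfl]
  obtain ⟨b, hb⟩ := hV.out.collection (φ.relabel (Sum.elim (Sum.elim Empty.elim fun _ => 1) fun _ => 0))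
    a fun x hx => by
      obtain ⟨y, hy⟩ := h x hx
      exact ⟨y, (key x y).2 ((hy y).2 rfl)⟩
  have : Def V (fun c : V × PUnit => ∃ x, x ∈ₘ a ∧ P x c.1) := by
    have : Def V (fun c : V × V × PUnit => P c.1 c.2.1) := ⟨φ, hφ⟩
    infer_instance
  obtain ⟨d, hd⟩ := exists_sep (fun y => ∃ x, x ∈ₘ a ∧ P x y) b
  refine ⟨d, fun y => ⟨fun hy => ((hd y).1 hy).2, fun hy => (hd y).2 ⟨?_, hy⟩⟩⟩
  obtain ⟨x, hx, hxy⟩ := hy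
  obtain ⟨z, hz, hxz⟩ := hb x hx
  obtain ⟨w, hw⟩ := h x hx
  rwa [(hw y).1 hxy, ← (hw z).1 ((key x z).1 hxz)]

end

end SetModel

/-! ### Basic set theory and the natural numbers of the model -/

namespace SetModel

section

variable {V : Type u} [setLang.Structure V] [hV : Fact (IsModelZFCMinus V)]

theorem ext_mem {a b : V} (h : ∀ x, x ∈ₘ a ↔ x ∈ₘ b) : a = b :=
  hV.out.extensionality a b h

theorem exists_isPair (a b : V) : ∃ c, IsPair c a b := by
  obtain ⟨s, hs⟩ := hV.out.pairing a a
  obtain ⟨t, ht⟩ := hV.out.pairing a b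
  obtain ⟨c, hc⟩ := hV.out.pairing s t
  refine ⟨c, fun z => (hc z).trans (or_congr ?_ ?_)⟩
  · exact ⟨fun h => h ▸ hs, fun h => ext_mem fun x => (h x).trans (hs x).symm⟩
  · exact ⟨fun h => h ▸ ht, fun h => ext_mem fun x => (h x).trans (ht x).symm⟩


theorem IsPair.inj {c a b a' b' : V} (h : IsPair c a b)
    (h' : IsPair c a' b') : a = a' ∧ b = b' := by
  obtain ⟨s, hs⟩ := hV.out.pairing a a
  obtain ⟨t, ht⟩ := hV.out.pairing a b
  obtain ⟨t', ht'⟩ := hV.out.pairing a' b'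
  obtain rfl : a' = a := by
    rcases (h' s).1 ((h s).2 (Or.inl hs)) with e | e <;>
      simpa using (hs a').1 ((e a').2 (Or.inl rfl))
  have e1 : b = a' ∨ b = b' := by
    rcases (h' t).1 ((h t).2 (Or.inr ht)) with e | e
    · exact Or.inl (by simpa using (e b).1 ((ht b).2 (Or.inr rfl)))
    · exact (e b).1 ((ht b).2 (Or.inr rfl))
  have e2 : b' = a' ∨ b' = b := by
    rcases (h t').1 ((h' t').2 (Or.inr ht')) with e | e
    · exact Or.inl (by simpa using (e b').1 ((ht' b').2 (Or.inr rfl)))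
    · exact (e b').1 ((ht' b').2 (Or.inr rfl))
  grind

/-- The set `a ∪ {x}`. -/
theorem exists_insert (a x : V) : ∃ b : V, ∀ y, y ∈ₘ b ↔ y ∈ₘ a ∨ y = x := by
  obtain ⟨s, hs⟩ := hV.out.pairing x x
  obtain ⟨t, ht⟩ := hV.out.pairing a s
  obtain ⟨b, hb⟩ := hV.out.union t
  refine ⟨b, fun y => (hb y).trans ?_⟩
  constructor
  · rintro ⟨z, hz, hy⟩
    rcases (ht z).1 hz with rfl | rfl
    · exact Or.inl hy
    · exact Or.inr (by simpa using (hs y).1 hy)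
  · rintro (hy | rfl)
    · exact ⟨a, (ht a).2 (Or.inl rfl), hy⟩
    · exact ⟨s, (ht s).2 (Or.inr rfl), (hs y).2 (Or.inl rfl)⟩

theorem exists_union (a b : V) : ∃ c : V, ∀ y, y ∈ₘ c ↔ y ∈ₘ a ∨ y ∈ₘ b := by
  obtain ⟨t, ht⟩ := hV.out.pairing a b
  obtain ⟨c, hc⟩ := hV.out.union t
  refine ⟨c, fun y => (hc y).trans ?_⟩
  constructor
  · rintro ⟨z, hz, hy⟩
    rcases (ht z).1 hz with rfl | rfl
    exacts [Or.inl hy, Or.inr hy]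
  · rintro (hy | hy)
    exacts [⟨a, (ht a).2 (Or.inl rfl), hy⟩, ⟨b, (ht b).2 (Or.inr rfl), hy⟩]

theorem not_mem_self (x : V) : ¬ x ∈ₘ x := by
  intro h
  obtain ⟨s, hs⟩ := hV.out.pairing x x
  obtain ⟨y, hy, hy'⟩ := hV.out.foundation s ⟨x, (hs x).2 (Or.inl rfl)⟩
  obtain rfl : y = x := by simpa using (hs y).1 hy
  exact hy' y h hy

/-- Every definable function on a set is an element of the model. -/
theorem exists_graph (P : V → V → Prop) [hP : Def V (fun c : V × V × PUnit => P c.1 c.2.1)]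
    (a : V) (h : ∀ x, x ∈ₘ a → ∃ y, ∀ z, P x z ↔ z = y) :
    ∃ f : V, ∀ x y, PairMem f x y ↔ x ∈ₘ a ∧ P x y := by
  -- Makes `P` usable by instance search at arbitrary terms in any context.
  have : ∀ {C : Type u} [Ctx V C] (f g : C → V) [Tm f] [Tm g],
    Def V fun c => P (f c) (g c) := fun f g hf hg => Def.subst₂ hP hf hg
  obtain ⟨f, hf⟩ := exists_image (fun x c => ∃ y, P x y ∧ IsPair c x y) a fun x hx => by
    obtain ⟨y, hy⟩ := h x hx
    obtain ⟨c, hc⟩ := exists_isPair x y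
    refine ⟨c, fun z => ⟨?_, ?_⟩⟩
    · rintro ⟨y', h1, h2⟩
      obtain rfl := (hy y').1 h1
      exact ext_mem fun w => (h2 w).trans (hc w).symm
    · rintro rfl
      exact ⟨y, (hy y).2 rfl, hc⟩
  refine ⟨f, fun x y => ⟨?_, ?_⟩⟩
  · rintro ⟨c, hc, hcf⟩
    obtain ⟨x', hx', y', hP', hc'⟩ := (hf c).1 hcf
    obtain ⟨rfl, rfl⟩ := hc.inj hc'
    exact ⟨hx', hP'⟩
  · rintro ⟨hx, hxy⟩
    obtain ⟨c, hc⟩ := exists_isPair x y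
    exact ⟨c, hc, (hf c).2 ⟨x, hx, y, hxy, hc⟩⟩

variable (V) in
theorem exists_zero : ∃ z : V, IsNat z ∧ ∀ x, ¬ x ∈ₘ z := by
  obtain ⟨w, ⟨e, -, he⟩, -⟩ := hV.out.infinity
  refine ⟨e, fun w' hw' => ?_, he⟩
  obtain ⟨e', he'w, he'⟩ := hw'.1
  rwa [ext_mem (a := e) (b := e') fun x => by simp [he x, he' x] ]

theorem exists_succ (n : Omega V) : ∃ m : Omega V, ∀ x, x ∈ₘ m.1 ↔ x ∈ₘ n.1 ∨ x = n.1 := by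
  obtain ⟨m, hm⟩ := exists_insert n.1 n.1
  refine ⟨⟨m, fun w hw => ?_⟩, hm⟩
  obtain ⟨y, hyw, hy⟩ := hw.2 n.1 (n.2 w hw)
  rwa [ext_mem fun x => (hm x).trans (hy x).symm]

namespace Omega

noncomputable instance : Zero (Omega V) :=
  ⟨⟨(exists_zero V).choose, (exists_zero V).choose_spec.1⟩⟩

theorem not_mem_zero (x : V) : ¬ x ∈ₘ (0 : Omega V).1 :=
  (exists_zero V).choose_spec.2 x

/-- The successor of a natural number of `V`. -/
noncomputable def succ (n : Omega V) : Omega V :=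
  (exists_succ n).choose

theorem mem_succ {n : Omega V} {x : V} : x ∈ₘ n.succ.1 ↔ x ∈ₘ n.1 ∨ x = n.1 :=
  (exists_succ n).choose_spec x

/-- Induction for definable predicates. -/
theorem induction (P : V → Prop) [hP : Def V (fun c : V × PUnit => P c.1)]
    (h0 : P (0 : Omega V).1) (hs : ∀ n : Omega V, P n.1 → P n.succ.1) (n : Omega V) : P n.1 := by
  obtain ⟨w, hw⟩ := hV.out.infinity
  have : ∀ {C : Type u} [Ctx V C] (f : C → V) [Tm f], Def V fun c => P (f c) :=
    fun f hf => Def.subst₁ hP hf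
  obtain ⟨b, hb⟩ := exists_sep (fun x => IsNat x ∧ P x) w
  refine ((hb n.1).1 (n.2 b ⟨?_, fun x hx => ?_⟩)).2.2
  · exact ⟨(0 : Omega V).1, (hb _).2 ⟨(0 : Omega V).2 w hw, (0 : Omega V).2, h0⟩, not_mem_zero⟩
  · obtain ⟨-, hx, hPx⟩ := (hb x).1 hx
    let m : Omega V := ⟨x, hx⟩
    exact ⟨m.succ.1, (hb _).2 ⟨m.succ.2 w hw, m.succ.2, hs m hPx⟩, fun z => mem_succ⟩

theorem isNat_of_mem {n : Omega V} {x : V} (h : x ∈ₘ n.1) : IsNat x := by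
  refine induction (fun n => ∀ x, x ∈ₘ n → IsNat x) (fun x hx => (not_mem_zero x hx).elim) ?_ n x h
  intro n ih x hx
  rcases mem_succ.1 hx with hx | rfl
  exacts [ih x hx, n.2]

theorem mem_trans {n : Omega V} {x y : V} (h : x ∈ₘ y) (h' : y ∈ₘ n.1) : x ∈ₘ n.1 := by
  refine induction (fun n => ∀ x y, x ∈ₘ y → y ∈ₘ n → x ∈ₘ n)
    (fun x y _ hy => (not_mem_zero y hy).elim) ?_ n x y h h'
  intro n ih x y hx hy
  rcases mem_succ.1 hy with hy | rfl
  exacts [mem_succ.2 (Or.inl (ih x y hx hy)), mem_succ.2 (Or.inl hx)]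

theorem eq_zero_or_zero_mem (n : Omega V) : n.1 = (0 : Omega V).1 ∨ (0 : Omega V).1 ∈ₘ n.1 := by
  refine induction (fun n => n = (0 : Omega V).1 ∨ (0 : Omega V).1 ∈ₘ n) (Or.inl rfl) ?_ n
  intro n ih
  rcases ih with h | h
  exacts [Or.inr (mem_succ.2 (Or.inr h.symm)), Or.inr (mem_succ.2 (Or.inl h))]

theorem succ_le_of_mem (m n : Omega V) (h : m.1 ∈ₘ n.1) : m.succ.1 = n.1 ∨ m.succ.1 ∈ₘ n.1 := by
  -- `succ` is not a term of the language, so the successor of `m` enters through its defining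
  -- property, as `s`.
  have key := induction (V := V) (fun n => ∀ m, m ∈ₘ n → ∀ s, (∀ x, x ∈ₘ s ↔ x ∈ₘ m ∨ x = m) →
    s = n ∨ s ∈ₘ n) (fun x hx => (not_mem_zero x hx).elim) ?_ n
  · exact key m.1 h m.succ.1 fun x => mem_succ
  intro n ih m hm s hs
  rcases mem_succ.1 hm with hm | rfl
  · rcases ih m hm s hs with h | h
    exacts [Or.inr (mem_succ.2 (Or.inr h)), Or.inr (mem_succ.2 (Or.inl h))]
  · exact Or.inl (ext_mem fun x => (hs x).trans mem_succ.symm)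

theorem trichotomy (m n : Omega V) : m.1 ∈ₘ n.1 ∨ m.1 = n.1 ∨ n.1 ∈ₘ m.1 := by
  refine induction (V := V) (fun n => ∀ m, IsNat m → m ∈ₘ n ∨ m = n ∨ n ∈ₘ m) ?_ ?_ n m.1 m.2
  · exact fun m hm => Or.inr (eq_zero_or_zero_mem ⟨m, hm⟩)
  · intro n ih m hm
    rcases ih m hm with h | rfl | h
    · exact Or.inl (mem_succ.2 (Or.inl h))
    · exact Or.inl (mem_succ.2 (Or.inr rfl))
    · rcases succ_le_of_mem n ⟨m, hm⟩ h with h | h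
      exacts [Or.inr (Or.inl h.symm), Or.inr (Or.inr h)]

noncomputable instance : LinearOrder (Omega V) where
  lt m n := m.1 ∈ₘ n.1
  le m n := m.1 ∈ₘ n.1 ∨ m.1 = n.1
  le_refl m := Or.inr rfl
  le_trans l m n h h' := by
    rcases h with h | h
    · rcases h' with h' | h'
      exacts [Or.inl (mem_trans h h'), Or.inl (h' ▸ h)]
    · rwa [h]
  le_antisymm m n h h' := by
    rcases h with h | h
    · rcases h' with h' | h'
      exacts [(not_mem_self _ (mem_trans h h')).elim, Subtype.ext h'.symm]
    · exact Subtype.ext h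
  le_total m n := by rcases trichotomy m n with h | h | h <;> simp [h]
  lt_iff_le_not_ge m n := by
    constructor
    · refine fun h => ⟨Or.inl h, ?_⟩
      rintro (h' | h')
      exacts [not_mem_self _ (mem_trans h h'), not_mem_self _ (h' ▸ h)]
    · rintro ⟨h | h, h'⟩
      exacts [h, (h' (Or.inr h.symm)).elim]
  toDecidableLE := Classical.decRel _

theorem lt_succ_iff {m n : Omega V} : m < n.succ ↔ m ≤ n := mem_succ

theorem lt_succ_self (n : Omega V) : n < n.succ := lt_succ_iff.2 le_rfl

/-- The least number principle for definable predicates. -/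
theorem exists_least (P : V → Prop) [hP : Def V (fun c : V × PUnit => P c.1)]
    (h : ∃ n : Omega V, P n.1) : ∃ n : Omega V, P n.1 ∧ ∀ m : Omega V, P m.1 → n ≤ m := by
  obtain ⟨n, hn⟩ := h
  obtain ⟨b, hb⟩ := exists_sep P n.succ.1
  obtain ⟨x, hx, hmin⟩ := hV.out.foundation b ⟨n.1, (hb _).2 ⟨mem_succ.2 (Or.inr rfl), hn⟩⟩
  obtain ⟨hxn, hPx⟩ := (hb x).1 hx
  refine ⟨⟨x, isNat_of_mem hxn⟩, hPx, fun m hm => not_lt.1 fun hlt => ?_⟩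
  exact hmin m.1 hlt ((hb _).2 ⟨mem_trans hlt hxn, hm⟩)

/-- A definable predicate which holds for some number below `z` holds for a greatest such. -/
theorem exists_greatest (P : V → Prop) [hP : Def V (fun c : V × PUnit => P c.1)] (z : Omega V)
    (h : ∃ n : Omega V, n ≤ z ∧ P n.1) :
    ∃ n : Omega V, n ≤ z ∧ P n.1 ∧ ∀ m : Omega V, m ≤ z → P m.1 → m ≤ n := by
  have : ∀ {C : Type u} [Ctx V C] (f : C → V) [Tm f], Def V fun c => P (f c) :=
    fun f hf => Def.subst₁ hP hf
  have key := induction (V := V) (fun z => (∃ n, IsNat n ∧ (n ∈ₘ z ∨ n = z) ∧ P n) →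
    ∃ n, IsNat n ∧ (n ∈ₘ z ∨ n = z) ∧ P n ∧
      ∀ m, IsNat m → (m ∈ₘ z ∨ m = z) → P m → m ∈ₘ n ∨ m = n) ?_ ?_ z ?_
  · obtain ⟨n, hn, h1, h2, h3⟩ := key
    exact ⟨⟨n, hn⟩, h1, h2, fun m => h3 m.1 m.2⟩
  · rintro ⟨n, hn, h | rfl, h'⟩
    · exact (not_mem_zero _ h).elim
    · exact ⟨_, hn, Or.inr rfl, h', fun m _ hm _ => hm⟩
  · rintro z ih ⟨n, hn, hnz, hPn⟩
    by_cases hz : P z.succ.1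
    · exact ⟨_, z.succ.2, Or.inr rfl, hz, fun m _ hm _ => hm⟩
    have aux : ∀ m, P m → (m ∈ₘ z.succ.1 ∨ m = z.succ.1) → (m ∈ₘ z.1 ∨ m = z.1) := by
      rintro m hm (h | rfl)
      exacts [mem_succ.1 h, (hz hm).elim]
    obtain ⟨m, h1, h2, h3, h4⟩ := ih ⟨n, hn, aux n hPn hnz, hPn⟩
    exact ⟨m, h1, Or.inl (mem_succ.2 h2), h3, fun k hk hkz hPk => h4 k hk (aux k hPk hkz) hPk⟩
  · obtain ⟨n, hnz, hPn⟩ := h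
    exact ⟨n.1, n.2, hnz, hPn⟩

end Omega

end

end SetModel

/-! ### Lexicographic coding of the subsets of a natural number -/

namespace SetModel

section

variable {V : Type u} [setLang.Structure V]

/-- `V` satisfies `a ⊆ b`. -/
def Sub (a b : V) : Prop := ∀ x, x ∈ₘ a → x ∈ₘ b

/-- The lexicographic order of the subsets of the natural number `k`, the largest elements
being the most significant. -/
def Lex (k c d : V) : Prop :=
  ∃ m, m ∈ₘ k ∧ m ∈ₘ d ∧ ¬ m ∈ₘ c ∧ ∀ i, i ∈ₘ k → m ∈ₘ i → (i ∈ₘ c ↔ i ∈ₘ d)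

/-- `V` satisfies "`f` maps each subset of `k` to an element of `b`, preserving `Lex`". -/
def IsLexCode (k f b : V) : Prop :=
  (∀ c, Sub c k → ∃ y, y ∈ₘ b ∧ ∀ z, PairMem f c z ↔ z = y) ∧
  ∀ c d y z, Sub c k → Sub d k → Lex k c d → PairMem f c y → PairMem f d z → y ∈ₘ z

instance {C : Type u} [Ctx V C] {f g : C → V} [hf : Tm f] [hg : Tm g] :
    Def V (fun c => Sub (f c) (g c)) := by
  refine Def.subst₂ ?_ hf hg
  unfold Sub; infer_instance

instance {C : Type u} [Ctx V C] {f g h : C → V} [hf : Tm f] [hg : Tm g] [hh : Tm h] :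
    Def V (fun c => Lex (f c) (g c) (h c)) := by
  refine Def.subst₃ ?_ hf hg hh
  unfold Lex; infer_instance

instance {C : Type u} [Ctx V C] {f g h : C → V} [hf : Tm f] [hg : Tm g] [hh : Tm h] :
    Def V (fun c => IsLexCode (f c) (g c) (h c)) := by
  refine Def.subst₃ ?_ hf hg hh
  unfold IsLexCode; infer_instance

variable [hV : Fact (IsModelZFCMinus V)]

theorem Sub.antisymm {a b : V} (h : Sub a b) (h' : Sub b a) : a = b :=
  ext_mem fun x => ⟨h x, h' x⟩

namespace Omega

/-- Replaces the missing power set axiom: the subsets of `n + 1` are the subsets `c` of `n` and the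
sets `c ∪ {n}`, the latter obtained by replacement. -/
theorem exists_powerset (n : Omega V) : ∃ q : V, ∀ c, c ∈ₘ q ↔ Sub c n.1 := by
  refine induction (fun n => ∃ q : V, ∀ c, c ∈ₘ q ↔ Sub c n) ?_ ?_ n
  · obtain ⟨s, hs⟩ := hV.out.pairing (0 : Omega V).1 (0 : Omega V).1
    refine ⟨s, fun c => (hs c).trans ⟨?_, fun h => Or.inl ?_⟩⟩
    · rintro (rfl | rfl) <;> exact fun x hx => hx
    · exact h.antisymm fun x hx => (not_mem_zero x hx).elim
  · rintro n ⟨q, hq⟩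
    obtain ⟨r, hr⟩ := exists_image (fun c d => ∀ x, x ∈ₘ d ↔ x ∈ₘ c ∨ x = n.1) q fun c _ => by
      obtain ⟨d, hd⟩ := exists_insert c n.1
      refine ⟨d, fun e => ⟨fun h => ext_mem fun x => (h x).trans (hd x).symm, ?_⟩⟩
      rintro rfl; exact hd
    obtain ⟨t, ht⟩ := exists_union q r
    refine ⟨t, fun c => ⟨fun hc x hx => ?_, fun hc => ?_⟩⟩
    · rcases (ht c).1 hc with h | h
      · exact mem_succ.2 (Or.inl ((hq c).1 h x hx))
      · obtain ⟨d, hd, hcd⟩ := (hr c).1 h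
        exact mem_succ.2 (((hcd x).1 hx).imp_left ((hq d).1 hd x))
    · by_cases hn : n.1 ∈ₘ c
      · obtain ⟨d, hd⟩ := exists_sep (fun x => ¬ x = n.1) c
        refine (ht c).2 (Or.inr ((hr c).2 ⟨d, (hq d).2 fun x hx => ?_, fun x => ?_⟩))
        · obtain ⟨h1, h2⟩ := (hd x).1 hx
          exact (mem_succ.1 (hc x h1)).resolve_right h2
        · grind
      · refine (ht c).2 (Or.inl ((hq c).2 fun x hx => ?_))
        exact (mem_succ.1 (hc x hx)).resolve_right fun h => hn (h ▸ hx)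

/-- There is a strictly increasing function from `n` to the numbers from `a` on, in the model. -/
theorem exists_shift (a n : Omega V) : ∃ s b : V, IsNat b ∧ (a.1 ∈ₘ b ∨ a.1 = b) ∧
    (∀ x, x ∈ₘ n.1 → ∃ y, (a.1 ∈ₘ y ∨ a.1 = y) ∧ y ∈ₘ b ∧ ∀ z, PairMem s x z ↔ z = y) ∧
    ∀ x x' y y', x' ∈ₘ n.1 → x ∈ₘ x' → PairMem s x y → PairMem s x' y' → y ∈ₘ y' := by
  refine induction (fun n => ∃ s b : V, IsNat b ∧ (a.1 ∈ₘ b ∨ a.1 = b) ∧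
    (∀ x, x ∈ₘ n → ∃ y, (a.1 ∈ₘ y ∨ a.1 = y) ∧ y ∈ₘ b ∧ ∀ z, PairMem s x z ↔ z = y) ∧
    ∀ x x' y y', x' ∈ₘ n → x ∈ₘ x' → PairMem s x y → PairMem s x' y' → y ∈ₘ y') ?_ ?_ n
  · exact ⟨a.1, a.1, a.2, Or.inr rfl, fun x hx => (not_mem_zero x hx).elim,
      fun x x' y y' hx => (not_mem_zero x' hx).elim⟩
  · rintro n ⟨s, b, hb, hab, hs, hmono⟩
    have hbs : b ∈ₘ (succ ⟨b, hb⟩).1 := lt_succ_self ⟨b, hb⟩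
    have hval : ∀ x, x ∈ₘ n.succ.1 → ∃ y, (a.1 ∈ₘ y ∨ a.1 = y) ∧ y ∈ₘ (succ ⟨b, hb⟩).1 ∧
        ∀ z, (x ∈ₘ n.1 ∧ PairMem s x z ∨ x = n.1 ∧ z = b) ↔ z = y := by
      intro x hx
      rcases mem_succ.1 hx with hx | rfl
      · obtain ⟨y, h1, h2, h3⟩ := hs x hx
        refine ⟨y, h1, mem_succ.2 (Or.inl h2), fun z => ?_⟩
        rw [← h3 z]
        exact ⟨fun h => h.elim And.right fun h => (not_mem_self n.1 (h.1 ▸ hx)).elim,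
          fun h => Or.inl ⟨hx, h⟩⟩
      · refine ⟨b, hab, hbs, fun z => ?_⟩
        exact ⟨fun h => h.elim (fun h => (not_mem_self _ h.1).elim) And.right,
          fun h => Or.inr ⟨rfl, h⟩⟩
    -- The new top element `n` is sent to the old bound `b`, and the bound moves up by one.
    obtain ⟨t, ht⟩ := exists_graph (fun x y => x ∈ₘ n.1 ∧ PairMem s x y ∨ x = n.1 ∧ y = b)
      n.succ.1 fun x hx => (hval x hx).imp fun y h => h.2.2
    refine ⟨t, (succ ⟨b, hb⟩).1, (succ ⟨b, hb⟩).2, ?_, fun x hx => ?_, ?_⟩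
    · rcases hab with h | h
      exacts [Or.inl (mem_succ.2 (Or.inl h)), Or.inl (h ▸ hbs)]
    · obtain ⟨y, h1, h2, h3⟩ := hval x hx
      exact ⟨y, h1, h2, fun z => by rw [← h3 z, ht]; exact and_iff_right hx⟩
    · intro x x' y y' hx' hxx' hy hy'
      obtain ⟨-, hy⟩ := (ht x y).1 hy
      obtain ⟨-, hy'⟩ := (ht x' y').1 hy'
      rcases hy' with ⟨hx'n, hy'⟩ | ⟨rfl, rfl⟩
      · rcases hy with ⟨hxn, hy⟩ | ⟨rfl, rfl⟩
        · exact hmono x x' y y' hx'n hxx' hy hy'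
        · exact (not_mem_self n.1 (mem_trans hxx' hx'n)).elim
      · rcases hy with ⟨hxn, hy⟩ | ⟨rfl, rfl⟩
        · obtain ⟨w, -, hw, hw'⟩ := hs x hxn
          rwa [(hw' y).1 hy]
        · exact (not_mem_self _ hxx').elim

/-- In the induction step, a subset of `k + 1` avoiding `k` keeps its old code, which is below `b`.
A subset containing `k` gets the code of its trace on `k`, shifted to `b` or beyond. This agrees
with `k` being the most significant element. -/
theorem exists_isLexCode (k : Omega V) : ∃ f b : V, IsNat b ∧ IsLexCode k.1 f b := by
  refine induction (fun k => ∃ f b : V, IsNat b ∧ IsLexCode k f b) ?_ ?_ k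
  · obtain ⟨s, hs⟩ := hV.out.pairing (0 : Omega V).1 (0 : Omega V).1
    obtain ⟨f, hf⟩ := exists_graph (fun _ y : V => y = (0 : Omega V).1) s fun x _ =>
      ⟨_, fun _ => Iff.rfl⟩
    refine ⟨f, (succ 0).1, (succ 0).2, fun c hc => ⟨_, lt_succ_self 0, fun z => ?_⟩, ?_⟩
    · rw [hf]
      refine and_iff_right ((hs c).2 (Or.inl (hc.antisymm fun x hx => (not_mem_zero x hx).elim)))
    · rintro c d y z - - ⟨m, hm, -⟩
      exact (not_mem_zero m hm).elim
  · rintro k ⟨f, b, hb, hf, hmono⟩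
    obtain ⟨q, hq⟩ := exists_powerset k.succ
    obtain ⟨s, b', hb', hbb', hs, hsmono⟩ := exists_shift ⟨b, hb⟩ ⟨b, hb⟩
    have hdel : ∀ c, Sub c k.succ.1 → ∃ c', Sub c' k.1 ∧ ∀ x, x ∈ₘ c' ↔ x ∈ₘ c ∧ ¬ x = k.1 := by
      intro c hc
      obtain ⟨c', hc'⟩ := exists_sep (fun x => ¬ x = k.1) c
      refine ⟨c', fun x hx => ?_, hc'⟩
      obtain ⟨h1, h2⟩ := (hc' x).1 hx
      exact (mem_succ.1 (hc x h1)).resolve_right h2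
    have hnot : ∀ c, Sub c k.succ.1 → ¬ k.1 ∈ₘ c → Sub c k.1 := fun c hc hk x hx =>
      (mem_succ.1 (hc x hx)).resolve_right fun h => hk (h ▸ hx)
    have hlt : ∀ y, y ∈ₘ b → y ∈ₘ b' := by
      intro y hy
      rcases hbb' with h | h
      exacts [mem_trans (n := ⟨b', hb'⟩) hy h, h ▸ hy]
    have hval : ∀ c, Sub c k.succ.1 → ∃ y, y ∈ₘ b' ∧ ∀ z, (¬ k.1 ∈ₘ c ∧ PairMem f c z ∨
        k.1 ∈ₘ c ∧ ∃ d t, (∀ x, x ∈ₘ d ↔ x ∈ₘ c ∧ ¬ x = k.1) ∧ PairMem f d t ∧ PairMem s t z) ↔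
          z = y := by
      intro c hc
      by_cases hk : k.1 ∈ₘ c
      · obtain ⟨d, hdk, hd⟩ := hdel c hc
        obtain ⟨t, htb, ht⟩ := hf d hdk
        obtain ⟨y, -, hyb, hy⟩ := hs t htb
        refine ⟨y, hyb, fun z => ?_⟩
        simp only [hk, not_true, false_and, true_and, false_or]
        constructor
        · rintro ⟨d', t', hd', ht', hz⟩
          obtain rfl : d' = d := ext_mem fun x => (hd' x).trans (hd x).symm
          obtain rfl := (ht t').1 ht'
          exact (hy z).1 hz
        · rintro rfl
          exact ⟨d, t, hd, (ht t).2 rfl, (hy z).2 rfl⟩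
      · obtain ⟨y, hyb, hy⟩ := hf c (hnot c hc hk)
        refine ⟨y, hlt y hyb, fun z => ?_⟩
        simp [hk, hy]
    obtain ⟨g, hg⟩ := exists_graph (fun c z => ¬ k.1 ∈ₘ c ∧ PairMem f c z ∨
        k.1 ∈ₘ c ∧ ∃ d t, (∀ x, x ∈ₘ d ↔ x ∈ₘ c ∧ ¬ x = k.1) ∧ PairMem f d t ∧ PairMem s t z)
      q fun c hc => (hval c ((hq c).1 hc)).imp fun y h => h.2
    refine ⟨g, b', hb', fun c hc => ?_, ?_⟩
    · obtain ⟨y, h1, h2⟩ := hval c hc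
      exact ⟨y, h1, fun z => by rw [← h2 z, hg]; exact and_iff_right ((hq c).2 hc)⟩
    rintro c d y z hc hd ⟨m, hm, hmd, hmc, hagree⟩ hy hz
    replace hy := ((hg c y).1 hy).2
    replace hz := ((hg d z).1 hz).2
    -- If the deciding element is below `k`, both sets lie on the same side and the old code or the
    -- shift is monotone. If it is `k`, only `d` contains `k`, so its code was shifted past that of
    -- `c`.
    rcases mem_succ.1 hm with hmk | rfl
    · have hk : k.1 ∈ₘ c ↔ k.1 ∈ₘ d := hagree k.1 (lt_succ_self k) hmk
      have hne : ∀ i, i ∈ₘ k.1 → ¬ i = k.1 := fun i hi h => not_mem_self k.1 (h ▸ hi)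
      rcases hy with ⟨hkc, hy⟩ | ⟨hkc, c', t, hc', ht, hy⟩
      · rcases hz with ⟨hkd, hz⟩ | ⟨hkd, -⟩
        · exact hmono c d y z (hnot c hc hkc) (hnot d hd hkd)
            ⟨m, hmk, hmd, hmc, fun i hi => hagree i (mem_succ.2 (Or.inl hi))⟩ hy hz
        · exact (hkc (hk.2 hkd)).elim
      · rcases hz with ⟨hkd, -⟩ | ⟨-, d', t', hd', ht', hz⟩
        · exact (hkd (hk.1 hkc)).elim
        · have hck : Sub c' k.1 := by
            obtain ⟨e, he, he'⟩ := hdel c hc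
            rwa [ext_mem fun x => (hc' x).trans (he' x).symm]
          have hdk : Sub d' k.1 := by
            obtain ⟨e, he, he'⟩ := hdel d hd
            rwa [ext_mem fun x => (hd' x).trans (he' x).symm]
          obtain ⟨w, hw, hw'⟩ := hf d' hdk
          refine hsmono t t' y z ((hw' t').1 ht' ▸ hw) ?_ hy hz
          refine hmono c' d' t t' hck hdk ⟨m, hmk, (hd' m).2 ⟨hmd, hne m hmk⟩,
            fun h => hmc ((hc' m).1 h).1, fun i hi hmi => ?_⟩ ht ht'
          rw [hc', hd', hagree i (mem_succ.2 (Or.inl hi)) hmi]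
    · rcases hy with ⟨hkc, hy⟩ | ⟨hkc, -⟩
      · rcases hz with ⟨hkd, -⟩ | ⟨-, d', t', hd', ht', hz⟩
        · exact (hkd hmd).elim
        · have hdk : Sub d' k.1 := by
            obtain ⟨e, he, he'⟩ := hdel d hd
            rwa [ext_mem fun x => (hd' x).trans (he' x).symm]
          obtain ⟨w, hw, hw'⟩ := hf d' hdk
          obtain ⟨v, hv, hv'⟩ := hf c (hnot c hc hkc)
          obtain ⟨r, hr, hrb, hr'⟩ := hs t' ((hw' t').1 ht' ▸ hw)
          obtain rfl := (hr' z).1 hz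
          obtain rfl := (hv' y).1 hy
          rcases hr with h | h
          · exact mem_trans (n := ⟨z, isNat_of_mem (n := ⟨b', hb'⟩) hrb⟩) hv h
          · exact h ▸ hv
      · exact (hmc hkc).elim

end Omega

/-- The greatest element at which `c` and `d` differ decides; it exists because the difference is
definable and bounded by `k`. -/
theorem lex_trichotomy (k : Omega V) {c d : V} (hc : Sub c k.1) (hd : Sub d k.1) :
    c = d ∨ Lex k.1 c d ∨ Lex k.1 d c := by
  by_cases h : c = d
  · exact Or.inl h
  have : ∃ x, x ∈ₘ k.1 ∧ ¬ (x ∈ₘ c ↔ x ∈ₘ d) := by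
    by_contra! hcon
    exact h (ext_mem fun x => ⟨fun hx => (hcon x (hc x hx)).1 hx, fun hx => (hcon x (hd x hx)).2 hx⟩)
  obtain ⟨x, hxk, hx⟩ := this
  obtain ⟨m, -, ⟨hmk, hm⟩, hmax⟩ := Omega.exists_greatest
    (fun x => x ∈ₘ k.1 ∧ ¬ (x ∈ₘ c ↔ x ∈ₘ d)) k ⟨⟨x, Omega.isNat_of_mem hxk⟩, Or.inl hxk, hxk, hx⟩
  have key : ∀ i, i ∈ₘ k.1 → m.1 ∈ₘ i → (i ∈ₘ c ↔ i ∈ₘ d) := by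
    intro i hi hmi
    by_contra hcon
    have := hmax ⟨i, Omega.isNat_of_mem hi⟩ (Or.inl hi) ⟨hi, hcon⟩
    exact absurd hmi (not_lt.2 this)
  by_cases hmd : m.1 ∈ₘ d
  · exact Or.inr (Or.inl ⟨m.1, hmk, hmd, by tauto, key⟩)
  · exact Or.inr (Or.inr ⟨m.1, hmk, by tauto, hmd, fun i h h' => (key i h h').symm⟩)

/-- An injection of the subsets of `k` into the natural numbers which preserves `Lex` and is an
element of the model. -/
structure LexCode (k : Omega V) where
  graph : V
  code : V → Omega V
  bound : Omega V
  pairMem_iff : ∀ c, Sub c k.1 → ∀ y, PairMem graph c y ↔ y = (code c).1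
  code_lt_bound : ∀ c, Sub c k.1 → code c < bound
  code_lt_code : ∀ c d, Sub c k.1 → Sub d k.1 → Lex k.1 c d → code c < code d

theorem nonempty_lexCode (k : Omega V) : Nonempty (LexCode k) := by
  obtain ⟨f, b, hb, hf, hmono⟩ := Omega.exists_isLexCode k
  have : ∀ c, ∃ y : Omega V, Sub c k.1 → y.1 ∈ₘ b ∧ ∀ z, PairMem f c z ↔ z = y.1 := by
    intro c
    by_cases hc : Sub c k.1
    · obtain ⟨y, hy, hy'⟩ := hf c hc
      exact ⟨⟨y, Omega.isNat_of_mem (n := ⟨b, hb⟩) hy⟩, fun _ => ⟨hy, hy'⟩⟩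
    · exact ⟨0, fun h => (hc h).elim⟩
  choose g hg using this
  exact ⟨⟨f, g, ⟨b, hb⟩, fun c hc => (hg c hc).2, fun c hc => (hg c hc).1, fun c d hc hd h =>
    hmono c d _ _ hc hd h (((hg c hc).2 _).2 rfl) (((hg d hd).2 _).2 rfl)⟩⟩

namespace LexCode

variable {k : Omega V} (e : LexCode k)

theorem code_le_code {c d : V} (hc : Sub c k.1) (hd : Sub d k.1) (h : ¬ Lex k.1 d c) :
    e.code c ≤ e.code d := by
  rcases lex_trichotomy k hc hd with rfl | h' | h'
  exacts [le_rfl, (e.code_lt_code c d hc hd h').le, (h h').elim]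

theorem code_injective {c d : V} (hc : Sub c k.1) (hd : Sub d k.1) (h : e.code c = e.code d) :
    c = d := by
  rcases lex_trichotomy k hc hd with rfl | h' | h'
  exacts [rfl, ((e.code_lt_code c d hc hd h').ne h).elim,
    ((e.code_lt_code d c hd hc h').ne' h).elim]

/-- Codes go down along inclusion, so a descending sequence can be stored as the bare set of its
codes: the order of its terms is read off from the codes. -/
theorem code_le_code_of_sub {c d : V} (hd : Sub d k.1) (h : Sub c d) :
    e.code c ≤ e.code d :=
  e.code_le_code (fun x hx => hd x (h x hx)) hd fun ⟨m, _, hm, hm', _⟩ => hm' (h m hm)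

end LexCode

end

end SetModel

/-! ### Cuts in linear orders and climbing along chains -/

namespace SetModel

/-- A linear order without maximum has a strictly increasing cofinal sequence of regular length. -/
theorem exists_regular_cofinal_seq (α : Type u) [LinearOrder α] [Nonempty α] [NoMaxOrder α] :
    ∃ (κ : Cardinal.{u}) (f : Set.Iio κ.ord → α), κ.IsRegular ∧ κ ≤ #α ∧ StrictMono f ∧
      ∀ x, ∃ i, x ≤ f i := by
  obtain ⟨s, hs, hwf⟩ : ∃ s : Set α, IsCofinal s ∧ WellFoundedLT s := by
    -- The records, exceeding all their predecessors in a well-order of `α`, are cofinal, and on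
    -- them `<` implies the well-order.
    refine ⟨_, isCofinal_setOfPred_imp_lt WellOrderingRel, ⟨?_⟩⟩
    refine Subrelation.wf (r := InvImage WellOrderingRel Subtype.val) ?_
      (InvImage.wf _ WellOrderingRel.isWellOrder.wf)
    rintro ⟨x, hx⟩ ⟨y, hy⟩ (hxy : x < y)
    refine (trichotomous_of WellOrderingRel x y).resolve_right ?_
    rintro (rfl | h)
    exacts [hxy.false, (hxy.trans (hx y h)).false]
  obtain ⟨t, ht, htype⟩ := Ordinal.exists_ord_cof_eq s
  let κ := Order.cof s
  have hκα : κ = Order.cof α := Order.cof_eq_of_isCofinal hs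
  refine ⟨κ, fun i => (Ordinal.enum (α := t) (· < ·) ⟨i.1, ?_⟩).1.1, ⟨?_, ?_⟩, ?_, ?_, ?_⟩
  · exact i.2.trans_eq htype.symm
  · rw [hκα]; exact Order.aleph0_le_cof
  · exact (Order.cof_ord_cof s).ge
  · rw [hκα]; exact Order.cof_le_cardinalMk α
  · intro i j hij
    exact (Ordinal.enum (α := t) (· < ·)).map_rel_iff.2 (show (⟨i.1, _⟩ : Set.Iio _) < ⟨j.1, _⟩ from hij)
  · intro x
    obtain ⟨y, hy, hxy⟩ := hs.trans ht x
    obtain ⟨⟨z, hzs⟩, hz, rfl⟩ := hy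
    refine ⟨⟨Ordinal.typein (α := t) (· < ·) ⟨⟨z, hzs⟩, hz⟩, ?_⟩, ?_⟩
    · exact (Ordinal.typein_lt_type _ _).trans_eq htype
    · simpa using hxy

/-- Small sets `D ≤ E` in a linear order are separated by a point. -/
theorem exists_between_of_card_lt_cut {L : Type u} [LinearOrder L] {D E : Set L}
    (hD : D.Nonempty) (hE : E.Nonempty) (hDc : #D < cut L) (hEc : #E < cut L)
    (h : ∀ d ∈ D, ∀ e ∈ E, d ≤ e) : ∃ c, (∀ d ∈ D, d ≤ c) ∧ ∀ e ∈ E, c ≤ e := by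
  by_contra! hcon
  -- A maximum of `D` or a minimum of `E` would itself separate the two sets.
  have hD' : ∀ d ∈ D, ∃ d' ∈ D, d < d' := by
    intro d hd
    by_contra! hmax
    obtain ⟨e, he, hed⟩ := hcon d hmax
    exact (h d hd e he).not_gt hed
  have hE' : ∀ e ∈ E, ∃ e' ∈ E, e' < e := by
    intro e he
    by_contra! hmin
    obtain ⟨e', he', h'⟩ := hcon e fun d hd => h d hd e he
    exact (hmin e' he').not_gt h'
  have := hD.to_subtype
  have : Nonempty (Eᵒᵈ : Type u) := hE.to_subtype
  have : NoMaxOrder D := ⟨fun d => let ⟨d', h1, h2⟩ := hD' d.1 d.2; ⟨⟨d', h1⟩, h2⟩⟩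
  have : NoMaxOrder (Eᵒᵈ : Type u) :=
    ⟨fun e => let ⟨e', h1, h2⟩ := hE' (OrderDual.ofDual e).1 (OrderDual.ofDual e).2
      ⟨OrderDual.toDual ⟨e', h1⟩, h2⟩⟩
  obtain ⟨κ, f, hκ, hκD, hf, hfc⟩ := exists_regular_cofinal_seq D
  obtain ⟨θ, g, hθ, hθE, hg, hgc⟩ := exists_regular_cofinal_seq (Eᵒᵈ : Type u)
  let b : Set.Iio θ.ord → L := fun i => (OrderDual.ofDual (g i)).1
  have hbE : ∀ i, b i ∈ E := fun i => (OrderDual.ofDual (g i)).2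
  have hmem : (κ, θ) ∈ cutSpectrum L := by
    refine ⟨hκ, hθ, fun i => (f i).1, b, fun i i' j j' hi hj => ⟨hf hi, ?_, hg hj⟩, ?_⟩
    · obtain ⟨d, hd, hlt⟩ := hD' _ (f i').2
      exact hlt.trans_le (h d hd _ (hbE j'))
    · rintro ⟨c, hc⟩
      obtain ⟨e, he, hlt⟩ := hcon c fun d hd => by
        obtain ⟨i, hi⟩ := hfc ⟨d, hd⟩
        exact le_trans hi (hc i ⟨0, hθ.ord_pos⟩).1.le
      obtain ⟨j, hj⟩ := hgc (OrderDual.toDual ⟨e, he⟩)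
      exact ((hc ⟨0, hκ.ord_pos⟩ j).2.trans_le hj).not_gt hlt
  have hle : cut L ≤ κ + θ := csInf_le' ⟨(κ, θ), hmem, rfl⟩
  have hinf : ℵ₀ ≤ cut L := hκ.aleph0_le.trans (hκD.trans hDc.le)
  exact hle.not_gt (add_lt_of_lt hinf (hκD.trans_lt hDc) (hθE.trans_lt hEc))

/-- If small chains have upper bounds satisfying any one of the upward closed conditions `Q i`, then
some element satisfies all of them. -/
theorem exists_forall_of_chain_step {ι S : Type u} [Nonempty ι] (le : S → S → Prop)
    (hrefl : ∀ s, le s s) (Q : ι → S → Prop) (hQ : ∀ i s t, le s t → Q i s → Q i t) (s₀ : S)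
    (hstep : ∀ (i : ι) (T : Set S), #T ≤ #ι → T.Nonempty →
      (∀ s ∈ T, ∀ t ∈ T, le s t ∨ le t s) → ∃ s, Q i s ∧ ∀ t ∈ T, le t s) :
    ∃ s, ∀ i, Q i s := by
  classical
  let r : ι → ι → Prop := WellOrderingRel
  have hwf : WellFounded r := WellOrderingRel.isWellOrder.wf
  -- `s₀` is only a default value; `key` shows that the first branch always applies.
  let f : ι → S := hwf.fix fun i prev =>
    if h : ∃ s, Q i s ∧ ∀ j (hj : r j i), le (prev j hj) s then h.choose else s₀
  have hf : ∀ i, (∃ s, Q i s ∧ ∀ j, r j i → le (f j) s) →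
      Q i (f i) ∧ ∀ j, r j i → le (f j) (f i) := by
    intro i h
    have : f i = h.choose := by
      change hwf.fix _ i = _
      rw [hwf.fix_eq]
      exact dif_pos h
    rw [this]
    exact h.choose_spec
  have key : ∀ i, Q i (f i) ∧ ∀ j, r j i → le (f j) (f i) := by
    intro i
    induction i using hwf.induction with
    | _ i ih =>
      refine hf i ?_
      by_cases hi : ∃ j, r j i
      · obtain ⟨s, hs, hs'⟩ := hstep i (f '' {j | r j i})
          (mk_image_le.trans (mk_set_le _)) (hi.elim fun j hj => ⟨f j, j, hj, rfl⟩) (by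
            rintro _ ⟨j, hj, rfl⟩ _ ⟨l, hl, rfl⟩
            rcases trichotomous_of r j l with h | rfl | h
            exacts [Or.inl ((ih l hl).2 j h), Or.inl (hrefl _), Or.inr ((ih j hj).2 l h)])
        exact ⟨s, hs, fun j hj => hs' _ ⟨j, hj, rfl⟩⟩
      -- At the least index there are no predecessors, and `{s₀}` serves as the nonempty chain.
      · obtain ⟨s, hs, -⟩ := hstep i {s₀} (by
          rw [mk_singleton]; exact Cardinal.one_le_iff_ne_zero.2 (mk_ne_zero ι)) ⟨s₀, rfl⟩ (by
            rintro _ rfl _ rfl; exact Or.inl (hrefl _))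
        exact ⟨s, hs, fun j hj => (hi ⟨j, hj⟩).elim⟩
  obtain ⟨s, -, hs⟩ := hstep (Classical.arbitrary ι) (Set.range f) mk_range_le
    (Set.range_nonempty f) (by
      rintro _ ⟨j, rfl⟩ _ ⟨l, rfl⟩
      rcases trichotomous_of r j l with h | rfl | h
      exacts [Or.inl ((key l).2 j h), Or.inl (hrefl _), Or.inr ((key j).2 l h)])
  exact ⟨s, fun i => hQ i _ _ (hs _ ⟨i, rfl⟩) (key i).1⟩

end SetModel

/-! ### The tree of descending sequences -/

namespace SetModel

section

variable {V : Type u} [setLang.Structure V]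

/-- A node of the tree of descending sequences of subsets of `k` which meet all sets in `F`: `cur`
is the last term of the sequence, and `path` is the set of codes of its terms. -/
structure Node [Fact (IsModelZFCMinus V)] {k : Omega V} (e : LexCode k) (F : Set V) where
  path : V
  cur : V
  path_sub : Sub path e.bound.1
  cur_sub : Sub cur k.1
  code_mem : (e.code cur).1 ∈ₘ path
  sub_of_le : ∀ v, Sub v k.1 → (e.code v).1 ∈ₘ path → e.code cur ≤ e.code v → Sub cur v
  meets : ∀ A ∈ F, ∃ x, x ∈ₘ cur ∧ x ∈ₘ A

namespace Node

variable [hV : Fact (IsModelZFCMinus V)] {k : Omega V} {e : LexCode k} {F : Set V}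

/-- The tree order: `t` extends `s`. -/
def Le (s t : Node e F) : Prop :=
  e.code t.cur ≤ e.code s.cur ∧
    ∀ i : Omega V, e.code s.cur ≤ i → (i.1 ∈ₘ s.path ↔ i.1 ∈ₘ t.path)

theorem Le.refl (s : Node e F) : s.Le s := ⟨le_rfl, fun _ _ => Iff.rfl⟩

theorem Le.cur_sub {s t : Node e F} (h : s.Le t) : Sub t.cur s.cur :=
  t.sub_of_le s.cur s.cur_sub ((h.2 _ le_rfl).1 s.code_mem) h.1

/-- A small chain of nodes is contained in a path. -/
theorem exists_path {T : Set (Node e F)} (hT : T.Nonempty) (hc : #T < pCard V)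
    (hchain : ∀ s ∈ T, ∀ t ∈ T, s.Le t ∨ t.Le s) :
    ∃ c, Sub c e.bound.1 ∧
      ∀ s ∈ T, ∀ i : Omega V, e.code s.cur ≤ i → (i.1 ∈ₘ s.path ↔ i.1 ∈ₘ c) := by
  obtain ⟨e'⟩ := nonempty_lexCode e.bound
  -- `l s` and `r s` are the lexicographically least and greatest subsets of the bound that agree
  -- with `s.path` from the code of `s.cur` on.
  choose l hl using fun s : Node e F => exists_sep (fun x => ¬ x ∈ₘ (e.code s.cur).1) s.path
  choose r hr using fun s : Node e F =>
    exists_sep (fun x => x ∈ₘ s.path ∨ x ∈ₘ (e.code s.cur).1) e.bound.1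
  have hlb : ∀ s, Sub (l s) e.bound.1 := fun s x hx => s.path_sub x ((hl s x).1 hx).1
  have hrb : ∀ s, Sub (r s) e.bound.1 := fun s x hx => ((hr s x).1 hx).1
  have hlr : ∀ s ∈ T, ∀ t ∈ T, e'.code (l s) ≤ e'.code (r t) := by
    intro s hs t ht
    refine e'.code_le_code (hlb s) (hrb t) ?_
    rintro ⟨m, hm, hml, hmr, -⟩
    obtain ⟨hms, hm1⟩ := (hl s m).1 hml
    have hmt : ¬ m ∈ₘ t.path := fun h => hmr ((hr t m).2 ⟨hm, Or.inl h⟩)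
    have hm2 : ¬ m ∈ₘ (e.code t.cur).1 := fun h => hmr ((hr t m).2 ⟨hm, Or.inr h⟩)
    let n : Omega V := ⟨m, Omega.isNat_of_mem hm⟩
    rcases hchain s hs t ht with h | h
    · exact hmt ((h.2 n (not_lt.1 hm1)).1 hms)
    · exact hmt ((h.2 n (not_lt.1 hm2)).2 hms)
  obtain ⟨z, hz1, hz2⟩ := exists_between_of_card_lt_cut (L := Omega V)
    (D := (fun s => e'.code (l s)) '' T) (E := (fun s => e'.code (r s)) '' T)
    (hT.image _) (hT.image _) (mk_image_le.trans_lt hc) (mk_image_le.trans_lt hc) (by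
      rintro _ ⟨s, hs, rfl⟩ _ ⟨t, ht, rfl⟩
      exact hlr s hs t ht)
  have hcode : ∀ c, Sub c e.bound.1 → PairMem e'.graph c (e'.code c).1 := fun c hc =>
    (e'.pairMem_iff c hc _).2 rfl
  -- The separating number `z` need not be a code. The greatest code up to `z` still lies above the
  -- codes of all `l s`, as these are codes up to `z`.
  obtain ⟨n, hnz, ⟨c, hcb, hcn⟩, hmax⟩ := Omega.exists_greatest
    (fun n => ∃ c, Sub c e.bound.1 ∧ PairMem e'.graph c n) z
    (hT.elim fun s hs => ⟨e'.code (l s), hz1 _ ⟨s, hs, rfl⟩, l s, hlb s, hcode _ (hlb s)⟩)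
  obtain rfl : n = e'.code c := Subtype.ext ((e'.pairMem_iff c hcb _).1 hcn)
  refine ⟨c, hcb, fun s hs => ?_⟩
  by_contra! hcon
  have hdiff : ∃ i : Omega V, i < e.bound ∧ ¬ i.1 ∈ₘ (e.code s.cur).1 ∧
      ¬ (i.1 ∈ₘ s.path ↔ i.1 ∈ₘ c) := by
    obtain ⟨i, hi, hi'⟩ := hcon
    refine ⟨i, ?_, not_lt.2 hi, by tauto⟩
    rcases hi' with h | h
    exacts [s.path_sub _ h.1, hcb _ h.2]
  -- The highest disagreement decides the lexicographic comparison: if `m ∈ c` then `c` exceeds `r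
  -- s`, otherwise `c` is below `l s`.
  obtain ⟨m, -, ⟨hmb, hmc, hm⟩, hmmax⟩ := Omega.exists_greatest
    (fun i => i ∈ₘ e.bound.1 ∧ ¬ i ∈ₘ (e.code s.cur).1 ∧ ¬ (i ∈ₘ s.path ↔ i ∈ₘ c)) e.bound
    (hdiff.imp fun i hi => ⟨Or.inl hi.1, hi⟩)
  have hagree : ∀ i, i ∈ₘ e.bound.1 → m.1 ∈ₘ i →
      ¬ i ∈ₘ (e.code s.cur).1 ∧ (i ∈ₘ s.path ↔ i ∈ₘ c) := by
    intro i hi hmi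
    let j : Omega V := ⟨i, Omega.isNat_of_mem hi⟩
    have hmj : m < j := hmi
    have h1 : ¬ i ∈ₘ (e.code s.cur).1 := fun h => hmc (lt_trans hmj h)
    refine ⟨h1, ?_⟩
    by_contra hcon
    exact (hmmax j (Or.inl hi) ⟨hi, h1, hcon⟩).not_gt hmj
  by_cases hmem : m.1 ∈ₘ c
  · have hms : ¬ m.1 ∈ₘ s.path := by tauto
    have := e'.code_lt_code (r s) c (hrb s) hcb ⟨m.1, hmb, hmem,
      fun h => ((hr s _).1 h).2.elim hms hmc, fun i hi hmi => by
        have := hagree i hi hmi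
        rw [hr]; tauto⟩
    exact (hnz.trans (hz2 _ ⟨s, hs, rfl⟩)).not_gt this
  · have hms : m.1 ∈ₘ s.path := by tauto
    have := e'.code_lt_code c (l s) hcb (hlb s) ⟨m.1, hmb, (hl s _).2 ⟨hms, hmc⟩,
      hmem, fun i hi hmi => by
        have := hagree i hi hmi
        rw [hl]; tauto⟩
    exact this.not_ge (hmax _ (hz1 _ ⟨s, hs, rfl⟩) ⟨l s, hlb s, hcode _ (hlb s)⟩)

/-- A small chain of nodes has an upper bound. -/
theorem exists_upper_bound (hF : F.Nonempty) (hFc : #F < pCard V) {T : Set (Node e F)}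
    (hT : T.Nonempty) (hc : #T < pCard V) (hchain : ∀ s ∈ T, ∀ t ∈ T, s.Le t ∨ t.Le s) :
    ∃ u : Node e F, ∀ s ∈ T, s.Le u := by
  obtain ⟨c, hcb, hcT⟩ := exists_path hT hc hchain
  have hcode : ∀ w, Sub w k.1 → PairMem e.graph w (e.code w).1 := fun w hw =>
    (e.pairMem_iff w hw _).2 rfl
  -- `T` is external, so the terms where `c` still behaves like a descending sequence are singled
  -- out definably: `w` is contained in every term on `c` with a code at least its own.
  let good : V → V → Prop := fun w a => Sub w k.1 ∧ PairMem e.graph w a ∧ a ∈ₘ c ∧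
    ∀ v b, Sub v k.1 → PairMem e.graph v b → b ∈ₘ c → (a ∈ₘ b ∨ a = b) → Sub w v
  have good_sub : ∀ w v, good w (e.code w).1 → Sub v k.1 → (e.code v).1 ∈ₘ c →
      e.code w ≤ e.code v → Sub w v := fun w v hw hv hvc hle =>
    hw.2.2.2 v _ hv (hcode v hv) hvc hle
  have good_code : ∀ w (a : Omega V), good w a.1 → a = e.code w := fun w a h =>
    Subtype.ext ((e.pairMem_iff w h.1 _).1 h.2.1)
  have hgood : ∀ s ∈ T, good s.cur (e.code s.cur).1 := by
    refine fun s hs => ⟨s.cur_sub, hcode _ s.cur_sub, (hcT s hs _ le_rfl).1 s.code_mem, ?_⟩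
    intro v b hv hb hbc hle
    obtain rfl := (e.pairMem_iff v hv b).1 hb
    exact s.sub_of_le v hv ((hcT s hs _ hle).2 hbc) hle
  have hgoodDef : ∀ {C : Type u} [Ctx V C] (f g : C → V) [Tm f] [Tm g],
      Def V fun c => good (f c) (g c) := fun f g hf hg =>
    Def.subst₂ (by unfold good; infer_instance) hf hg
  have hleast : ∀ A ∈ F, ∃ n : Omega V, (∃ w, good w n.1 ∧ ∃ x, x ∈ₘ w ∧ x ∈ₘ A) ∧
      ∀ m : Omega V, (∃ w, good w m.1 ∧ ∃ x, x ∈ₘ w ∧ x ∈ₘ A) → n ≤ m := fun A hA =>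
    Omega.exists_least (fun n => ∃ w, good w n ∧ ∃ x, x ∈ₘ w ∧ x ∈ₘ A)
      (hT.elim fun s hs => ⟨e.code s.cur, s.cur, hgood s hs, s.meets A hA⟩)
  -- `n A` is the last place along `c` where a good term meets `A`. Since the last term of each node
  -- in `T` is good and meets `A`, `n A` is at most its code.
  choose! n hn hnmin using hleast
  obtain ⟨z, hz1, hz2⟩ := exists_between_of_card_lt_cut (L := Omega V)
    (D := n '' F) (E := (fun s => e.code s.cur) '' T)
    (hF.image _) (hT.image _) (mk_image_le.trans_lt hFc) (mk_image_le.trans_lt hc) (by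
      rintro _ ⟨A, hA, rfl⟩ _ ⟨s, hs, rfl⟩
      exact hnmin A hA _ ⟨s.cur, hgood s hs, s.meets A hA⟩)
  -- The sequence stops at the least good code from `z` on. It is at most the code of every `s.cur`,
  -- and at least every `n A`, so `w` contains the good term at `n A` and meets `A`.
  obtain ⟨m, ⟨hzm, w, hw⟩, hmmin⟩ := Omega.exists_least
    (fun m => (z.1 ∈ₘ m ∨ z.1 = m) ∧ ∃ w, good w m)
    (hT.elim fun s hs => ⟨e.code s.cur, hz2 _ ⟨s, hs, rfl⟩, s.cur, hgood s hs⟩)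
  obtain rfl := good_code w m hw
  refine ⟨⟨c, w, hcb, hw.1, hw.2.2.1, fun v hv => good_sub w v hw hv, fun A hA => ?_⟩,
    fun s hs => ⟨hmmin _ ⟨hz2 _ ⟨s, hs, rfl⟩, s.cur, hgood s hs⟩, hcT s hs⟩⟩
  obtain ⟨v, hv, x, hxv, hxA⟩ := hn A hA
  have hnv := good_code v _ hv
  rw [hnv] at hv
  refine ⟨x, good_sub v w hv hw.1 hw.2.2.1 ?_ x hxv, hxA⟩
  rw [← hnv]
  exact (hz1 _ ⟨A, hA, rfl⟩).trans hzm

/-- Each node extends to a node whose last term is contained in a given set in `F`. -/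
theorem exists_refinement (hdir : ∀ A ∈ F, ∀ B ∈ F, ∃ C ∈ F, Sub C A ∧ Sub C B) (s : Node e F)
    {A : V} (hA : A ∈ F) : ∃ t : Node e F, Sub t.cur A ∧ ∀ r : Node e F, r.Le s → r.Le t := by
  obtain ⟨w, hw⟩ := exists_sep (fun x => x ∈ₘ A) s.cur
  have hws : Sub w s.cur := fun x hx => ((hw x).1 hx).1
  have hwk : Sub w k.1 := fun x hx => s.cur_sub x (hws x hx)
  have hle : e.code w ≤ e.code s.cur := e.code_le_code_of_sub s.cur_sub hws
  -- Entries of `s.path` below the code of `s.cur` are unconstrained, so they are discarded before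
  -- the new term is added.
  obtain ⟨c₀, hc₀⟩ := exists_sep (fun x => ¬ x ∈ₘ (e.code s.cur).1) s.path
  obtain ⟨c, hc⟩ := exists_insert c₀ (e.code w).1
  have hagree : ∀ i : Omega V, e.code s.cur ≤ i → (i.1 ∈ₘ s.path ↔ i.1 ∈ₘ c) := by
    intro i hi
    have hi' : ¬ i.1 ∈ₘ (e.code s.cur).1 := not_lt.2 hi
    rw [hc, hc₀, and_iff_left hi']
    refine ⟨Or.inl, fun h => h.elim id fun h => ?_⟩
    obtain rfl : i = e.code w := Subtype.ext h
    rw [le_antisymm hle hi]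
    exact s.code_mem
  refine ⟨⟨c, w, fun x hx => ?_, hwk, (hc _).2 (Or.inr rfl), fun v hv hvc hwv => ?_,
    fun B hB => ?_⟩, fun x hx => ((hw x).1 hx).2, fun r hr => ⟨hle.trans hr.1, fun i hi => ?_⟩⟩
  · rcases (hc x).1 hx with h | rfl
    exacts [s.path_sub x ((hc₀ x).1 h).1, e.code_lt_bound w hwk]
  · rcases (hc _).1 hvc with h | h
    · obtain ⟨h1, h2⟩ := (hc₀ _).1 h
      exact fun x hx => s.sub_of_le v hv h1 (not_lt.1 h2) x (hws x hx)
    · rw [e.code_injective hv hwk (Subtype.ext h)]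
      exact fun x hx => hx
  -- `s.cur` meets some `C ⊆ A ∩ B` in `F`, hence `w = s.cur ∩ A` meets `B`.
  · obtain ⟨C, hCF, hCA, hCB⟩ := hdir A hA B hB
    obtain ⟨x, hx, hxC⟩ := s.meets C hCF
    exact ⟨x, (hw x).2 ⟨hx, hCA x hxC⟩, hCB x hxC⟩
  · rw [hr.2 i hi]
    exact hagree i (hr.1.trans hi)

end Node

variable [hV : Fact (IsModelZFCMinus V)]

/-- A small directed family of nonempty subsets of a natural number has a common element. -/
theorem exists_mem_of_directed (k : Omega V) {F : Set V} (hF : F.Nonempty) (hFc : #F < pCard V)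
    (hdir : ∀ A ∈ F, ∀ B ∈ F, ∃ C ∈ F, Sub C A ∧ Sub C B) (hsub : ∀ A ∈ F, Sub A k.1)
    (hne : ∀ A ∈ F, ∃ x, x ∈ₘ A) : ∃ x, x ∈ₘ k.1 ∧ ∀ A ∈ F, x ∈ₘ A := by
  obtain ⟨e⟩ := nonempty_lexCode k
  have hkk : Sub k.1 k.1 := fun x hx => hx
  obtain ⟨c, hc⟩ := hV.out.pairing (e.code k.1).1 (e.code k.1).1
  simp only [IsUPair, or_self] at hc
  -- The root is the one-term sequence `k`.
  let s₀ : Node e F :=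
    { path := c
      cur := k.1
      path_sub := fun x hx => (hc x).1 hx ▸ e.code_lt_bound k.1 hkk
      cur_sub := hkk
      code_mem := (hc _).2 rfl
      sub_of_le := fun v hv hvc _ => by
        rw [e.code_injective hv hkk (Subtype.ext ((hc _).1 hvc))]
        exact hkk
      meets := fun A hA => (hne A hA).imp fun x hx => ⟨hsub A hA x hx, hx⟩ }
  have := hF.to_subtype
  obtain ⟨s, hs⟩ := exists_forall_of_chain_step (ι := F) Node.Le Node.Le.refl
    (fun A (s : Node e F) => Sub s.cur A.1) (fun A s t hst h x hx => h x (hst.cur_sub x hx)) s₀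
    fun A T hTc hT hchain => by
      obtain ⟨u, hu⟩ := Node.exists_upper_bound hF hFc hT (hTc.trans_lt hFc) hchain
      obtain ⟨t, htA, ht⟩ := u.exists_refinement hdir A.2
      exact ⟨t, htA, fun r hr => ht r (hu r hr)⟩
  -- The final last term is contained in every member of `F`, and it is nonempty because it meets
  -- one of them.
  obtain ⟨A, hA⟩ := hF
  obtain ⟨x, hx, -⟩ := s.meets A hA
  exact ⟨x, s.cur_sub x hx, fun B hB => hs ⟨B, hB⟩ x hx⟩

end

end SetModel

/-! ### From types to directed families -/

namespace SetModel

theorem def_forall_realize {V C : Type u} [setLang.Structure V] [Ctx V C]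
    (u : Finset (setLang[[V]].Formula (Fin 1))) (f : C → V) [Tm f] :
    Def V (fun c => ∀ φ ∈ u, φ.Realize ![f c]) := by
  classical
  induction u using Finset.induction_on with
  | empty =>
    refine ⟨⊤, fun c => ?_⟩
    simp
  | insert φ u _ ih =>
    simp only [Finset.forall_mem_insert]
    infer_instance

end SetModel

theorem mainTheorem3 {V : Type u} [setLang.Structure V]
    (hV : SetModel.IsModelZFCMinus V) (hω : SetModel.OmegaNonstandard V)
    (p : Set (setLang[[V]].Formula (Fin 1))) (hp : SetModel.IsPartialType p)
    (hcard : #p < SetModel.pCard V)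
    (X : V) (hX : SetModel.Pseudofinite {x : V | SetModel.Mem x X})
    (hXp : SetModel.memFormula X ∈ p) :
    SetModel.IsRealized p := by
  classical
  by_cases hfin : p.Finite
  · exact hp p subset_rfl hfin
  have : Infinite p := Set.infinite_coe_iff.2 hfin
  have : Fact (SetModel.IsModelZFCMinus V) := ⟨hV⟩
  obtain ⟨Y, ⟨n, f, hn, hf⟩, hXY⟩ := hX
  -- `S u` is the image under `f` of the set of elements of `X` satisfying `u`. It exists by
  -- separation because `u` is truly finite, so its conjunction is one formula.
  choose S hS using fun u : Finset p => by
    have := fun {C : Type u} [SetModel.Ctx V C] (f : C → V) [SetModel.Tm f] =>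
      SetModel.def_forall_realize (u.map (Function.Embedding.subtype _)) f
    exact SetModel.exists_sep (fun i => ∃ x, SetModel.Mem x X ∧ SetModel.PairMem f x i ∧
      ∀ φ ∈ u.map (Function.Embedding.subtype _), φ.Realize ![x]) n
  have hSmono : ∀ u v, u ⊆ v → SetModel.Sub (S v) (S u) := by
    intro u v huv i hi
    obtain ⟨hin, x, hxX, hxi, hx⟩ := (hS v i).1 hi
    exact (hS u i).2 ⟨hin, x, hxX, hxi, fun φ hφ => hx φ (Finset.map_subset_map.2 huv hφ)⟩
  obtain ⟨i, hi, hiS⟩ := SetModel.exists_mem_of_directed ⟨n, hn⟩ (F := Set.range S)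
    (Set.range_nonempty S) (mk_range_le.trans_lt ((mk_finset_of_infinite p).trans_lt hcard)) (by
      rintro _ ⟨u, rfl⟩ _ ⟨v, rfl⟩
      exact ⟨_, ⟨u ∪ v, rfl⟩, hSmono _ _ Finset.subset_union_left,
        hSmono _ _ Finset.subset_union_right⟩) (by
      rintro _ ⟨u, rfl⟩ i hi
      exact ((hS u i).1 hi).1) (by
      rintro _ ⟨u, rfl⟩
      -- Adding `x ∈ X` to `u` puts the witness into the domain of `f`.
      obtain ⟨x, hx⟩ := hp (insert (SetModel.memFormula X)
          ↑(u.map (Function.Embedding.subtype _))) (by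
        rintro φ (rfl | hφ)
        · exact hXp
        · obtain ⟨ψ, -, rfl⟩ := Finset.mem_map.1 hφ
          exact ψ.2) ((Finset.finite_toSet _).insert _)
      have hxX := (SetModel.realize_memFormula X x).1 (hx _ (Set.mem_insert _ _))
      obtain ⟨i, hxi, -⟩ := hf.2.1 x (hXY x hxX)
      refine ⟨i, (hS u i).2 ⟨?_, x, hxX, hxi, fun φ hφ => hx φ (Set.mem_insert_of_mem _ hφ)⟩⟩
      obtain ⟨c, hc, hcf⟩ := hxi
      obtain ⟨x', i', -, hi', hc'⟩ := hf.1 c hcf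
      rwa [(hc.inj hc').2])
  obtain ⟨x, -, hx⟩ := hf.2.2 i hi
  refine ⟨x, fun φ hφ => ?_⟩
  -- Each formula may bring its own witness `y`, but injectivity of `f` identifies it with the
  -- preimage `x` of `i`.
  obtain ⟨-, y, -, hyi, hy⟩ := (hS {⟨φ, hφ⟩} i).1 (hiS _ ⟨_, rfl⟩)
  rw [← hx y hyi]
  exact hy φ (by simp)
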